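/- Let $\Gamma$ be a finite connected distance-regular graph with vertex set $X$, path-length distance $\partial$ and diameter $D\ge 1$, and let $V=\mathbb C^X$. For $0\le i\le D$ let $A_i\in \mathrm{Mat}_X(\mathbb C)$ be the $i$th distance matrix, with $(y,z)$-entry $1$ if $\partial(y,z)=i$ and $0$ otherwise, and let $M$ be the Bose--Mesner algebra, with basis $A_0,\dots,A_D$. Let $E_0,\dots,E_D$ be an ordering of the primitive idempotents of $M$ with $E_0=|X|^{-1}J$, where $J$ is the all-ones matrix. Define the Krein parameters $q^h_{i,j}$ by $E_i\circ E_j=|X|^{-1}\sum_{h=0}^D q^h_{i,j}E_h$, where $\circ$ is the entrywise product. Assume that $\Gamma$ is $Q$-polynomial with respect to this ordering: for $0\le h,i,j\le D$, $q^h_{i,j}=0$ if one of $h,i,j$ is greater than the sum of the other two, and $q^h_{i,j}\ne 0$ if one of $h,i,j$ is equal to the sum of the other two. Fix $x\in X$. For $0\le i\le D$ let $E^*_i\in\mathrm{Mat}_X(\mathbb C)$ be the diagonal matrix with $(y,y)$-entry $1$ if $\partial(x,y)=i$ and $0$ otherwise. Let $T=T(x)$ be the subalgebra of $\mathrm{Mat}_X(\mathbb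 C)$ generated by $M$ and $E^*_0,\dots,E^*_D$. A $T$-module is a subspace $W\subseteq V$ with $TW\subseteq W$; it is irreducible if $W\neq0$ and $W$ contains no $T$-module other than $0$ and $W$. The displacement of an irreducible $T$-module $W$ is the integer $r+t-D+d$, where $r=\min\{i: E^*_iW\ne0\}$, $t=\min\{i:E_iW\neq0\}$ and $d=|\{i:E^*_iW\ne0\}|-1$ (with $0 \le i \le D$ throughout). The nucleus of $\Gamma$ with respect to $x$ is the span of the irreducible $T$-modules of displacement $0$. For $0\le i\le D$ let $$\mathcal N_i=(E^*_0V+E^*_1V+\cdots+E^*_iV)\cap(E_0V+E_1V+\cdots+E_{D-i}V).$$ Then the sum $\sum_{i=0}^D\mathcal N_i$ is direct, and it is equal to the nucleus of $\Gamma$ with respect to $x$. -/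

import Mathlib

open scoped Matrix

namespace DRG

noncomputable section

variable {X : Type*} [Fintype X] [DecidableEq X]

/-- A finite connected graph is distance-regular when, for vertices `x, y`, the number
`|Γ_i(x) ∩ Γ_j(y)|` depends only on `i`, `j` and the distance of `x` and `y`. -/
def IsDistanceRegular (G : SimpleGraph X) : Prop :=
  G.Connected ∧
    ∀ x y x' y' : X, G.dist x y = G.dist x' y' → ∀ i j : ℕ,
      {z : X | G.dist x z = i ∧ G.dist y z = j}.ncard =
        {z : X | G.dist x' z = i ∧ G.dist y' z = j}.ncard

/-- The `i`th distance matrix `A_i`. -/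
def distMatrix (G : SimpleGraph X) (i : ℕ) : Matrix X X ℂ :=
  Matrix.of fun x y => if G.dist x y = i then 1 else 0

/-- The Bose-Mesner algebra `M` of a distance-regular graph of diameter `D`, as the span of the
distance matrices `A_0, …, A_D`. -/
def boseMesner (G : SimpleGraph X) (D : ℕ) : Submodule ℂ (Matrix X X ℂ) :=
  Submodule.span ℂ (Set.range fun i : Fin (D + 1) => distMatrix G i)

/-- `E_0, …, E_D` is an ordering, with `E_0 = |X|⁻¹ J`, of the primitive idempotents of the
graph: the basis of the Bose-Mesner algebra that consists of mutually orthogonal idempotents. -/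
structure IsPrimitiveIdempotents (G : SimpleGraph X) {D : ℕ}
    (E : Fin (D + 1) → Matrix X X ℂ) : Prop where
  linearIndependent : LinearIndependent ℂ E
  span_eq : Submodule.span ℂ (Set.range E) = boseMesner G D
  zero_eq : E 0 = Matrix.of fun _ _ => (Fintype.card X : ℂ)⁻¹
  sum_eq : ∑ i, E i = 1
  transpose_eq : ∀ i, (E i)ᵀ = E i
  conj_eq : ∀ i, (E i).map (starRingEnd ℂ) = E i
  mul_eq : ∀ i j, E i * E j = if i = j then E i else 0

/-- The scalars `q h i j` are the Krein parameters `q^h_{i,j}` for the ordering `E`: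
`E_i ∘ E_j = |X|⁻¹ ∑_h q^h_{i,j} E_h`, where `∘` is the entrywise product. When `E` is linearly
independent, at most one `q` has this property. -/
def IsKreinParameters {D : ℕ} (E : Fin (D + 1) → Matrix X X ℂ)
    (q : Fin (D + 1) → Fin (D + 1) → Fin (D + 1) → ℂ) : Prop :=
  ∀ i j, E i ⊙ E j = (Fintype.card X : ℂ)⁻¹ • ∑ h, q h i j • E h

/-- The `Q`-polynomial property with respect to the ordering `E` of the primitive idempotents. -/
def IsQPolynomial {D : ℕ} (E : Fin (D + 1) → Matrix X X ℂ) : Prop :=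
  ∃ q : Fin (D + 1) → Fin (D + 1) → Fin (D + 1) → ℂ, IsKreinParameters E q ∧
    ∀ h i j : Fin (D + 1),
      (((h : ℕ) > i + j ∨ (i : ℕ) > h + j ∨ (j : ℕ) > h + i) → q h i j = 0) ∧
      (((h : ℕ) = i + j ∨ (i : ℕ) = h + j ∨ (j : ℕ) = h + i) → q h i j ≠ 0)

/-- The dual primitive idempotents `E*_i = E*_i(x)`, `0 ≤ i ≤ D`. -/
def dualIdempotent (G : SimpleGraph X) (x : X) (D : ℕ) (i : Fin (D + 1)) : Matrix X X ℂ :=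
  Matrix.diagonal fun y => if G.dist x y = i then 1 else 0

/-- The dual Bose-Mesner algebra `M* = M*(x)`, as the span of `E*_0, …, E*_D`. -/
def dualBoseMesner (G : SimpleGraph X) (x : X) (D : ℕ) : Submodule ℂ (Matrix X X ℂ) :=
  Submodule.span ℂ (Set.range (dualIdempotent G x D))

/-- The subconstituent (Terwilliger) algebra `T = T(x)`, generated by `M` and `M*`. -/
def terwilliger (G : SimpleGraph X) (x : X) (D : ℕ) : Subalgebra ℂ (Matrix X X ℂ) :=
  Algebra.adjoin ℂ ((boseMesner G D : Set (Matrix X X ℂ)) ∪ dualBoseMesner G x D)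

/-- A `T`-module is a subspace of the standard module `V = ℂ^X` that is invariant under `T`. -/
def IsTModule (T : Subalgebra ℂ (Matrix X X ℂ)) (W : Submodule ℂ (X → ℂ)) : Prop :=
  ∀ B ∈ T, ∀ w ∈ W, B *ᵥ w ∈ W

/-- A `T`-module is irreducible when it is nonzero and contains no `T`-module besides `0` and
itself. -/
def IsIrreducibleTModule (T : Subalgebra ℂ (Matrix X X ℂ)) (W : Submodule ℂ (X → ℂ)) : Prop :=
  IsTModule T W ∧ W ≠ ⊥ ∧ ∀ U : Submodule ℂ (X → ℂ), IsTModule T U → U ≤ W → U = ⊥ ∨ U = W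

/-- The subspace `B W`. -/
def act (B : Matrix X X ℂ) (W : Submodule ℂ (X → ℂ)) : Submodule ℂ (X → ℂ) :=
  W.map (Matrix.toLin' B)

/-- For a sequence of matrices `F_0, …, F_D`, the set of `i` with `0 ≤ i ≤ D` and `F_i W ≠ 0`. -/
def support {D : ℕ} (F : Fin (D + 1) → Matrix X X ℂ) (W : Submodule ℂ (X → ℂ)) : Set ℕ :=
  {i | ∃ j : Fin (D + 1), (j : ℕ) = i ∧ act (F j) W ≠ ⊥}

/-- The endpoint of `W`: the least `i` with `E*_i W ≠ 0`. -/
def endpoint (G : SimpleGraph X) (x : X) (D : ℕ) (W : Submodule ℂ (X → ℂ)) : ℕ :=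
  sInf (support (dualIdempotent G x D) W)

/-- The dual endpoint of `W`: the least `i` with `E_i W ≠ 0`. -/
def dualEndpoint {D : ℕ} (E : Fin (D + 1) → Matrix X X ℂ) (W : Submodule ℂ (X → ℂ)) : ℕ :=
  sInf (support E W)

/-- The diameter of `W`: the number of `i` with `E*_i W ≠ 0`, minus one. -/
def diameter (G : SimpleGraph X) (x : X) (D : ℕ) (W : Submodule ℂ (X → ℂ)) : ℤ :=
  ((support (dualIdempotent G x D) W).ncard : ℤ) - 1

/-- The displacement `r + t - D + d` of `W`. -/
def displacement (G : SimpleGraph X) (x : X) {D : ℕ} (E : Fin (D + 1) → Matrix X X ℂ)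
    (W : Submodule ℂ (X → ℂ)) : ℤ :=
  (endpoint G x D W : ℤ) + dualEndpoint E W - D + diameter G x D W

/-- The nucleus with respect to `x`: the span of the irreducible `T`-modules of
displacement `0`. -/
def nucleus (G : SimpleGraph X) (x : X) {D : ℕ} (E : Fin (D + 1) → Matrix X X ℂ) :
    Submodule ℂ (X → ℂ) :=
  sSup {W | IsIrreducibleTModule (terwilliger G x D) W ∧ displacement G x E W = 0}

/-- `N_i = (E*_0 V + ⋯ + E*_i V) ∩ (E_0 V + ⋯ + E_{D-i} V)`, for `0 ≤ i ≤ D`. -/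
def nucleusPart (G : SimpleGraph X) (x : X) {D : ℕ} (E : Fin (D + 1) → Matrix X X ℂ)
    (i : Fin (D + 1)) : Submodule ℂ (X → ℂ) :=
  (⨆ j : Fin (D + 1), ⨆ _ : (j : ℕ) ≤ i, act (dualIdempotent G x D j) ⊤) ⊓
    (⨆ j : Fin (D + 1), ⨆ _ : (j : ℕ) ≤ D - i, act (E j) ⊤)

end

end DRG

/-! Write `F i` for the dual idempotents. Vectors that vanish on all `F j` with `j ≥ a` and on all
`E j` with `j ≥ b` form `low F a ⊓ low E b`; for fixed `n = a + b` their sum is `splitSum E F n`.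
This sum is a `T`-module: the adjacency matrix raises the `F`-support by at most one, while
subtracting an eigenvalue from it lowers the `E`-support, so it preserves the total `n`; the dual
adjacency matrix does the same with the roles exchanged. Since `low` uses strict bounds, the sum of
the `nucleusPart`s is the case `n = D + 2`.

Let `W` be irreducible, with extreme `F`-indices `r ≤ s` and extreme `E`-indices `t ≤ u`. The
vectors of `F r W` lie in the split sum of `W` for `n = r + u + 2`, which is therefore all of `W`;
but a split sum can fill `W` only if `n ≥ s + t + 2`. With the dual argument, `s + t = r + u`.
Moreover `D ≤ r + s`, because the last distance matrix is injective and moves `F r W` to indices at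
least `D - r`; dually `D ≤ t + u`. Hence `D ≤ s + t`. Supports are intervals, so the displacement is
`s + t - D`.

Thus displacement `0` means `r + u + 2 = D + 2`, and such a `W` lies in the split sum for `D + 2`.
Conversely, an irreducible module inside that split sum satisfies `s + t ≤ D`, so it has
displacement `0`; complete reducibility gives equality with the nucleus. For `n < D + 2` no
irreducible module fits, the split sum is zero, and directness follows. -/

namespace DRG

noncomputable section

variable {X : Type*} [Fintype X] {D : ℕ}

/-! ### Invariant subspaces, split sums and orthogonal complements -/

/-- The vectors annihilated by `F_j` for all `j ≥ k`. -/
def low (F : Fin (D + 1) → Matrix X X ℂ) (k : ℕ) : Submodule ℂ (X → ℂ) where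
  carrier := {v | ∀ j : Fin (D + 1), k ≤ j → F j *ᵥ v = 0}
  add_mem' := fun ha hb j hj => by rw [Matrix.mulVec_add, ha j hj, hb j hj, add_zero]
  zero_mem' := fun j _ => Matrix.mulVec_zero _
  smul_mem' := fun c v hv j hj => by rw [Matrix.mulVec_smul, hv j hj, smul_zero]

theorem low_mono (F : Fin (D + 1) → Matrix X X ℂ) {k l : ℕ} (h : k ≤ l) : low F k ≤ low F l :=
  fun _ hv j hj => hv j (h.trans hj)

/-- The subspace `W` is invariant under all `E_i` and all `F_i`. -/
def Inv (E F : Fin (D + 1) → Matrix X X ℂ) (W : Submodule ℂ (X → ℂ)) : Prop :=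
  (∀ i, ∀ v ∈ W, E i *ᵥ v ∈ W) ∧ ∀ i, ∀ v ∈ W, F i *ᵥ v ∈ W

/-- `W` is minimal among the nonzero subspaces invariant under all `E_i` and all `F_i`. -/
def Irr (E F : Fin (D + 1) → Matrix X X ℂ) (W : Submodule ℂ (X → ℂ)) : Prop :=
  Inv E F W ∧ W ≠ ⊥ ∧ ∀ U : Submodule ℂ (X → ℂ), Inv E F U → U ≤ W → U = ⊥ ∨ U = W

theorem Inv.swap {E F : Fin (D + 1) → Matrix X X ℂ} {W : Submodule ℂ (X → ℂ)}
    (h : Inv E F W) : Inv F E W := ⟨h.2, h.1⟩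

theorem Irr.swap {E F : Fin (D + 1) → Matrix X X ℂ} {W : Submodule ℂ (X → ℂ)}
    (h : Irr E F W) : Irr F E W := ⟨h.1.swap, h.2.1, fun U hU => h.2.2 U hU.swap⟩

/-- The sum over `a + b = n` of the subspaces of `W` of vectors supported on `F_j`, `j < a`, and
on `E_j`, `j < b`. -/
def splitSum (E F : Fin (D + 1) → Matrix X X ℂ) (n : ℕ) (W : Submodule ℂ (X → ℂ)) :
    Submodule ℂ (X → ℂ) :=
  ⨆ (a : ℕ) (b : ℕ) (_ : a + b = n), W ⊓ low F a ⊓ low E b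

theorem splitSum_swap (E F : Fin (D + 1) → Matrix X X ℂ) (n : ℕ) (W : Submodule ℂ (X → ℂ)) :
    splitSum F E n W = splitSum E F n W := by
  unfold splitSum
  rw [iSup_comm]
  refine iSup_congr fun a => iSup_congr fun b => ?_
  rw [add_comm, inf_right_comm]

theorem mem_splitSum {E F : Fin (D + 1) → Matrix X X ℂ} {n a b : ℕ} (hab : a + b = n)
    {W : Submodule ℂ (X → ℂ)} {v : X → ℂ} (hv : v ∈ W) (ha : v ∈ low F a) (hb : v ∈ low E b) :
    v ∈ splitSum E F n W :=
  le_iSup_of_le (f := fun a => ⨆ (b : ℕ) (_ : a + b = n), W ⊓ low F a ⊓ low E b) a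
    (le_iSup₂_of_le b hab le_rfl) ⟨⟨hv, ha⟩, hb⟩

theorem splitSum_le {E F : Fin (D + 1) → Matrix X X ℂ} {n : ℕ} {W U : Submodule ℂ (X → ℂ)}
    (h : ∀ a b : ℕ, a + b = n → ∀ v ∈ W, v ∈ low F a → v ∈ low E b → v ∈ U) :
    splitSum E F n W ≤ U :=
  iSup_le fun a => iSup₂_le fun b hab v hv => h a b hab v hv.1.1 hv.1.2 hv.2

theorem exists_irr_le {E F : Fin (D + 1) → Matrix X X ℂ} {U : Submodule ℂ (X → ℂ)}
    (hU : Inv E F U) (h0 : U ≠ ⊥) : ∃ W ≤ U, Irr E F W := by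
  obtain ⟨W, hW⟩ := exists_minimal_of_wellFoundedLT
    (fun W : Submodule ℂ (X → ℂ) => Inv E F W ∧ W ≠ ⊥ ∧ W ≤ U) ⟨U, hU, h0, le_rfl⟩
  refine ⟨W, hW.prop.2.2, hW.prop.1, hW.prop.2.1, fun V hV hVW => ?_⟩
  by_cases hV0 : V = ⊥
  · exact Or.inl hV0
  · exact Or.inr (hW.eq_of_le ⟨hV, hV0, hVW.trans hW.prop.2.2⟩ hVW)

/-- The orthogonal complement for the standard Hermitian form. -/
def perp (W : Submodule ℂ (X → ℂ)) : Submodule ℂ (X → ℂ) where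
  carrier := {v | ∀ w ∈ W, star w ⬝ᵥ v = 0}
  add_mem' := fun ha hb w hw => by rw [dotProduct_add, ha w hw, hb w hw, add_zero]
  zero_mem' := fun w _ => dotProduct_zero _
  smul_mem' := fun c v hv w hw => by rw [dotProduct_smul, hv w hw, smul_zero]

/-- The orthogonal decomposition is transported from `EuclideanSpace`, since `X → ℂ` carries the sup
norm. -/
theorem isCompl_perp (W : Submodule ℂ (X → ℂ)) : IsCompl W (perp W) := by
  let e := (WithLp.linearEquiv 2 ℂ (X → ℂ))
  have key : perp W = ((W.comap e.toLinearMap)ᗮ).map e.toLinearMap := by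
    ext v
    constructor
    · intro hv
      refine ⟨e.symm v, fun w hw => ?_, by simp⟩
      rw [EuclideanSpace.inner_eq_star_dotProduct, dotProduct_comm]
      exact hv _ hw
    · rintro ⟨u, hu, rfl⟩ w hw
      have := hu (e.symm w) (by simpa using hw)
      rw [EuclideanSpace.inner_eq_star_dotProduct, dotProduct_comm] at this
      exact this
  have hW : W = (W.comap e.toLinearMap).map e.toLinearMap :=
    (Submodule.map_comap_eq_of_surjective e.surjective W).symm
  rw [key]
  nth_rewrite 1 [hW]
  exact (Submodule.isCompl_orthogonal (W.comap e.toLinearMap)).map (Submodule.orderIsoMapComap e)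

theorem Inv.perp {E F : Fin (D + 1) → Matrix X X ℂ} {W : Submodule ℂ (X → ℂ)}
    (hE : ∀ i, (E i)ᴴ = E i) (hF : ∀ i, (F i)ᴴ = F i) (hW : Inv E F W) : Inv E F (perp W) := by
  refine ⟨fun i v hv w hw => ?_, fun i v hv w hw => ?_⟩
  · rw [Matrix.dotProduct_mulVec, ← hE i, ← Matrix.star_mulVec]
    exact hv _ (hW.1 i w hw)
  · rw [Matrix.dotProduct_mulVec, ← hF i, ← Matrix.star_mulVec]
    exact hv _ (hW.2 i w hw)

theorem inv_top {E F : Fin (D + 1) → Matrix X X ℂ} : Inv E F (⊤ : Submodule ℂ (X → ℂ)) :=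
  ⟨fun _ _ _ => trivial, fun _ _ _ => trivial⟩

theorem Inv.inf {E F : Fin (D + 1) → Matrix X X ℂ} {U W : Submodule ℂ (X → ℂ)}
    (hU : Inv E F U) (hW : Inv E F W) : Inv E F (U ⊓ W) :=
  ⟨fun i v hv => ⟨hU.1 i v hv.1, hW.1 i v hv.2⟩, fun i v hv => ⟨hU.2 i v hv.1, hW.2 i v hv.2⟩⟩

/-- `r` and `s` are the least and the greatest index `i` with `F_i W ≠ 0`. -/
structure HasRange (F : Fin (D + 1) → Matrix X X ℂ) (W : Submodule ℂ (X → ℂ))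
    (r s : Fin (D + 1)) : Prop where
  eq_zero_of_lt : ∀ i < r, ∀ v ∈ W, F i *ᵥ v = 0
  eq_zero_of_gt : ∀ i > s, ∀ v ∈ W, F i *ᵥ v = 0
  exists_left : ∃ v ∈ W, F r *ᵥ v ≠ 0
  exists_right : ∃ v ∈ W, F s *ᵥ v ≠ 0

theorem HasRange.le {F : Fin (D + 1) → Matrix X X ℂ} {W : Submodule ℂ (X → ℂ)}
    {r s : Fin (D + 1)} (hF : HasRange F W r s) : r ≤ s := by
  obtain ⟨v, hv, hv0⟩ := hF.exists_left
  exact not_lt.mp fun hlt => hv0 (hF.eq_zero_of_gt r hlt v hv)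

variable [DecidableEq X]

/-! ### Metric systems and invariance of split sums -/

/-- Matrices `A_0 = 1, A_1, …, A_D` subject to an irreducible three-term recurrence, whose span has
the Hermitian idempotents `E_0, …, E_D` as a system of generators, and which satisfy the triangle
inequality with respect to `F_0, …, F_D`. -/
structure IsMetricSystem (A E F : Fin (D + 1) → Matrix X X ℂ) : Prop where
  zero_eq : A 0 = 1
  recurrence : ∃ p : Fin (D + 1) → Fin (D + 1) → ℂ,
    (∀ i, A 1 * A i = ∑ h, p h i • A h) ∧
    (∀ h i : Fin (D + 1), ((h : ℕ) > i + 1 ∨ (i : ℕ) > h + 1) → p h i = 0) ∧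
    (∀ h i : Fin (D + 1), ((h : ℕ) = i + 1 ∨ (i : ℕ) = h + 1) → p h i ≠ 0)
  span_eq : Submodule.span ℂ (Set.range E) = Submodule.span ℂ (Set.range A)
  sum_eq : ∑ i, E i = 1
  mul_eq : ∀ i j, E i * E j = if i = j then E i else 0
  herm : ∀ i, (E i)ᴴ = E i
  triangle : ∀ h i j : Fin (D + 1),
    ((h : ℕ) > i + j ∨ (i : ℕ) > h + j ∨ (j : ℕ) > h + i) → F i * A h * F j = 0

namespace IsMetricSystem

variable {A E F B : Fin (D + 1) → Matrix X X ℂ}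

/-- Downward recursion: the recurrence for `A 1 * A (i + 1)` contains `A i` with nonzero coefficient
and otherwise only matrices of higher index, which already kill `u`. It ends at `A 0 = 1`. -/
theorem eq_zero_of_last_mulVec (h : IsMetricSystem A E F) {u : X → ℂ}
    (hu : A (Fin.last D) *ᵥ u = 0) : u = 0 := by
  obtain ⟨p, hp, hp0, hp1⟩ := h.recurrence
  have key : ∀ k : ℕ, ∀ i : Fin (D + 1), D ≤ i + k → A i *ᵥ u = 0 := by
    intro k
    induction k with
    | zero =>
      intro i hi
      have : i = Fin.last D := Fin.ext (by simp; omega)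
      rw [this, hu]
    | succ k ih =>
      intro i hi
      by_cases hik : D ≤ i + k
      · exact ih i hik
      have hlt : (i : ℕ) + 1 < D + 1 := by omega
      have e := congrArg (· *ᵥ u) (hp ⟨i + 1, hlt⟩)
      simp only [← Matrix.mulVec_mulVec, Matrix.sum_mulVec, Matrix.smul_mulVec] at e
      rw [ih ⟨i + 1, hlt⟩ (by simp; omega), Matrix.mulVec_zero, Finset.sum_eq_single i] at e
      · exact (smul_eq_zero.mp e.symm).resolve_left (hp1 _ _ (Or.inr rfl))
      · intro j _ hj
        rcases lt_or_gt_of_ne (fun hh => hj (Fin.ext hh) : (j : ℕ) ≠ i) with hj | hj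
        · rw [hp0 j _ (Or.inr (by simp; omega)), zero_smul]
        · rw [ih j (by omega), smul_zero]
      · simp
  simpa [h.zero_eq] using key D 0 (by omega)

/-- Upward recursion: `A 1 * A k` contains `A (k + 1)` with nonzero coefficient, so every `A i` is a
polynomial in `A 1`. Invariance under all the idempotents can then be tested on `A 1` alone. -/
theorem mem_adjoin (h : IsMetricSystem A E F) (i : Fin (D + 1)) :
    A i ∈ Algebra.adjoin ℂ {A 1} := by
  obtain ⟨p, hp, hp0, hp1⟩ := h.recurrence
  have key : ∀ k : ℕ, ∀ i : Fin (D + 1), (i : ℕ) ≤ k → A i ∈ Algebra.adjoin ℂ {A 1} := by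
    intro k
    induction k with
    | zero =>
      intro i hi
      have : i = 0 := Fin.ext (by simpa using hi)
      rw [this, h.zero_eq]
      exact one_mem _
    | succ k ih =>
      intro i hi
      by_cases hik : (i : ℕ) ≤ k
      · exact ih i hik
      have hik : (i : ℕ) = k + 1 := by omega
      have hk : k < D + 1 := by omega
      have e := hp ⟨k, hk⟩
      rw [← Finset.add_sum_erase _ _ (Finset.mem_univ i)] at e
      have hi : p i ⟨k, hk⟩ ≠ 0 := hp1 _ _ (Or.inl (by simpa using hik))
      have e' : A i = (p i ⟨k, hk⟩)⁻¹ • (A 1 * A ⟨k, hk⟩ -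
          ∑ j ∈ Finset.univ.erase i, p j ⟨k, hk⟩ • A j) := by
        rw [e, add_sub_cancel_right, inv_smul_smul₀ hi]
      rw [e']
      refine Subalgebra.smul_mem _ (sub_mem (mul_mem (Algebra.self_mem_adjoin_singleton _ _)
        (ih _ le_rfl)) (sum_mem fun j hj => ?_)) _
      by_cases hjk : (j : ℕ) ≤ k
      · exact Subalgebra.smul_mem _ (ih j hjk) _
      · have hne : (j : ℕ) ≠ i := fun hh => (Finset.ne_of_mem_erase hj) (Fin.ext hh)
        rw [hp0 j _ (Or.inl (by simp; omega)), zero_smul]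
        exact zero_mem _
  exact key i i le_rfl

theorem idempotent_mulVec_mem (h : IsMetricSystem A E F) {U : Submodule ℂ (X → ℂ)}
    (hU : ∀ v ∈ U, A 1 *ᵥ v ∈ U) (i : Fin (D + 1)) : ∀ v ∈ U, E i *ᵥ v ∈ U := by
  have hle : Submodule.span ℂ (Set.range E) ≤
      Subalgebra.toSubmodule (Algebra.adjoin ℂ {A 1}) := by
    rw [h.span_eq, Submodule.span_le]
    rintro _ ⟨j, rfl⟩
    exact h.mem_adjoin j
  have hi : E i ∈ Algebra.adjoin ℂ {A 1} := hle (Submodule.subset_span ⟨i, rfl⟩)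
  generalize E i = M at hi
  induction hi using Algebra.adjoin_induction with
  | mem x hx => rw [Set.mem_singleton_iff.mp hx]; exact hU
  | algebraMap r =>
    intro v hv
    rw [Algebra.algebraMap_eq_smul_one, Matrix.smul_mulVec, Matrix.one_mulVec]
    exact U.smul_mem _ hv
  | add x y _ _ hx hy =>
    intro v hv
    rw [Matrix.add_mulVec]
    exact U.add_mem (hx v hv) (hy v hv)
  | mul x y _ _ hx hy =>
    intro v hv
    rw [← Matrix.mulVec_mulVec]
    exact hx _ (hy v hv)

theorem mulVec_mem_of_idempotent (h : IsMetricSystem A E F) {U : Submodule ℂ (X → ℂ)}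
    (hU : ∀ i, ∀ v ∈ U, E i *ᵥ v ∈ U) (i : Fin (D + 1)) : ∀ v ∈ U, A i *ᵥ v ∈ U := by
  have hi : A i ∈ Submodule.span ℂ (Set.range E) := by
    rw [h.span_eq]; exact Submodule.subset_span ⟨i, rfl⟩
  intro v hv
  obtain ⟨c, hc⟩ := (Submodule.mem_span_range_iff_exists_fun ℂ).mp hi
  rw [← hc, Matrix.sum_mulVec]
  exact U.sum_mem fun j _ => by rw [Matrix.smul_mulVec]; exact U.smul_mem _ (hU j v hv)

theorem exists_eigenvalue (h : IsMetricSystem A E F) (i : Fin (D + 1)) :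
    ∃ θ : Fin (D + 1) → ℂ, ∀ j, E j * A i = θ j • E j := by
  have hi : A i ∈ Submodule.span ℂ (Set.range E) := by
    rw [h.span_eq]; exact Submodule.subset_span ⟨i, rfl⟩
  obtain ⟨c, hc⟩ := (Submodule.mem_span_range_iff_exists_fun ℂ).mp hi
  refine ⟨c, fun j => ?_⟩
  rw [← hc, Finset.mul_sum]
  simp [h.mul_eq]

theorem sum_mulVec (h : IsMetricSystem A E F) (v : X → ℂ) : ∑ i, E i *ᵥ v = v := by
  rw [← Matrix.sum_mulVec, h.sum_eq, Matrix.one_mulVec]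

theorem mulVec_mulVec (h : IsMetricSystem A E F) (i j : Fin (D + 1)) (v : X → ℂ) :
    E i *ᵥ E j *ᵥ v = if i = j then E i *ᵥ v else 0 := by
  rw [Matrix.mulVec_mulVec, h.mul_eq]
  split_ifs <;> simp

theorem mulVec_mem_low (h : IsMetricSystem A E F) {i : Fin (D + 1)} {k : ℕ} {v : X → ℂ}
    (hv : v ∈ low E k) : E i *ᵥ v ∈ low E k := by
  intro j hj
  rw [h.mulVec_mulVec]
  split_ifs
  · exact hv j hj
  · rfl

theorem low_zero (h : IsMetricSystem A E F) : low E 0 = ⊥ := by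
  refine (Submodule.eq_bot_iff _).mpr fun v hv => ?_
  rw [← h.sum_mulVec v]
  exact Finset.sum_eq_zero fun i _ => hv i (Nat.zero_le _)

theorem low_succ_eq_iSup (h : IsMetricSystem A E F) (k : ℕ) :
    low E (k + 1) = ⨆ j : Fin (D + 1), ⨆ _ : (j : ℕ) ≤ k, act (E j) ⊤ := by
  refine le_antisymm (fun v hv => ?_) (iSup₂_le fun j hj => ?_)
  · rw [← h.sum_mulVec v]
    refine Submodule.sum_mem _ fun j _ => ?_
    by_cases hj : (j : ℕ) ≤ k
    · exact le_iSup₂_of_le (f := fun (j : Fin (D + 1)) (_ : (j : ℕ) ≤ k) => act (E j) ⊤) j hj le_rfl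
        ⟨v, trivial, Matrix.toLin'_apply _ _⟩
    · rw [hv j (by omega)]
      exact Submodule.zero_mem _
  · rintro _ ⟨v, -, rfl⟩ i hi
    rw [Matrix.toLin'_apply, h.mulVec_mulVec, if_neg]
    rintro rfl
    omega

/-- `A_1` raises the `F`-support by at most one. -/
theorem one_mulVec_mem_low (hD : 1 ≤ D) (h : IsMetricSystem A E F) (h' : IsMetricSystem B F E)
    {k : ℕ} {v : X → ℂ} (hv : v ∈ low F k) : A 1 *ᵥ v ∈ low F (k + 1) := by
  intro j hj
  rw [← h'.sum_mulVec v, Matrix.mulVec_sum, Matrix.mulVec_sum]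
  refine Finset.sum_eq_zero fun i _ => ?_
  by_cases hi : k ≤ i
  · rw [hv i hi, Matrix.mulVec_zero, Matrix.mulVec_zero]
  · have h1 : ((1 : Fin (D + 1)) : ℕ) = 1 := by
      rw [Fin.val_one', Nat.mod_eq_of_lt (by omega)]
    rw [Matrix.mulVec_mulVec, Matrix.mulVec_mulVec,
      h.triangle 1 j i (Or.inr (Or.inl (by omega))), Matrix.zero_mulVec]

/-- Shifting `A_1` by a suitable eigenvalue lowers the `E`-support. -/
theorem exists_sub_smul_mem_low (h : IsMetricSystem A E F) (k : ℕ) :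
    ∃ θ : ℂ, ∀ v ∈ low E (k + 1), A 1 *ᵥ v - θ • v ∈ low E k := by
  obtain ⟨θ, hθ⟩ := h.exists_eigenvalue 1
  -- The shift is the eigenvalue of `A 1` on the image of `E k`, the only component to be removed.
  -- For `k > D` there is no such component and the default `0` is harmless.
  refine ⟨if hk : k < D + 1 then θ ⟨k, hk⟩ else 0, fun v hv j hj => ?_⟩
  rw [Matrix.mulVec_sub, Matrix.mulVec_smul, Matrix.mulVec_mulVec, hθ, Matrix.smul_mulVec]
  rcases Nat.lt_or_ge k j with hkj | hkj
  · rw [hv j hkj]; simp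
  · have hk : k = j := le_antisymm hj hkj
    subst hk
    rw [dif_pos j.2, sub_self]

/-- Split `A 1 v` as `(A 1 v - θ v) + θ v`: the first term moves from the summand `(a, b + 1)` to
`(a + 1, b)`, the second stays where it was. -/
theorem one_mulVec_mem_splitSum (hD : 1 ≤ D) (h : IsMetricSystem A E F)
    (h' : IsMetricSystem B F E) {W : Submodule ℂ (X → ℂ)} (hW : Inv E F W) (n : ℕ) :
    ∀ v ∈ splitSum E F n W, A 1 *ᵥ v ∈ splitSum E F n W := by
  suffices hs : splitSum E F n W ≤ (splitSum E F n W).comap (Matrix.toLin' (A 1)) from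
    fun v hv => by simpa using hs hv
  refine splitSum_le fun a b hab v hv ha hb => ?_
  rw [Submodule.mem_comap, Matrix.toLin'_apply]
  rcases b with _ | b
  · rw [h.low_zero, Submodule.mem_bot] at hb
    rw [hb, Matrix.mulVec_zero]
    exact Submodule.zero_mem _
  · obtain ⟨θ, hθ⟩ := h.exists_sub_smul_mem_low b
    rw [← sub_add_cancel (A 1 *ᵥ v) (θ • v)]
    refine Submodule.add_mem _ (mem_splitSum (a := a + 1) (b := b) (by omega) ?_ ?_ (hθ v hb))
      (Submodule.smul_mem _ _ (mem_splitSum hab hv ha hb))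
    · exact W.sub_mem (h.mulVec_mem_of_idempotent hW.1 1 v hv) (W.smul_mem _ hv)
    · exact Submodule.sub_mem _ (h.one_mulVec_mem_low hD h' ha)
        (Submodule.smul_mem _ _ (low_mono F (Nat.le_succ a) ha))

theorem inv_splitSum (hD : 1 ≤ D) (h : IsMetricSystem A E F) (h' : IsMetricSystem B F E)
    {W : Submodule ℂ (X → ℂ)} (hW : Inv E F W) (n : ℕ) : Inv E F (splitSum E F n W) := by
  refine ⟨h.idempotent_mulVec_mem (h.one_mulVec_mem_splitSum hD h' hW n), ?_⟩
  have := h'.one_mulVec_mem_splitSum hD h hW.swap n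
  rw [splitSum_swap] at this
  exact h'.idempotent_mulVec_mem this

end IsMetricSystem

/-! ### Supports of irreducible modules -/

namespace IsMetricSystem

variable {A E F B : Fin (D + 1) → Matrix X X ℂ} {W : Submodule ℂ (X → ℂ)}

theorem exists_hasRange (h : IsMetricSystem A E F) (hW : W ≠ ⊥) :
    ∃ r s, HasRange E W r s := by
  classical
  let S : Finset (Fin (D + 1)) := Finset.univ.filter fun i => ∃ v ∈ W, E i *ᵥ v ≠ 0
  have hS : S.Nonempty := by
    obtain ⟨v, hv, hv0⟩ := W.ne_bot_iff.mp hW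
    by_contra hne
    refine hv0 ?_
    rw [← h.sum_mulVec v]
    refine Finset.sum_eq_zero fun i _ => ?_
    by_contra hi
    exact hne ⟨i, by simpa [S] using ⟨v, hv, hi⟩⟩
  refine ⟨S.min' hS, S.max' hS, ?_, ?_, ?_, ?_⟩
  · intro i hi v hv
    by_contra hne
    exact absurd (S.min'_le i (by simpa [S] using ⟨v, hv, hne⟩)) (not_le.mpr hi)
  · intro i hi v hv
    by_contra hne
    exact absurd (S.le_max' i (by simpa [S] using ⟨v, hv, hne⟩)) (not_le.mpr hi)
  · simpa [S] using S.min'_mem hS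
  · simpa [S] using S.max'_mem hS

theorem mulVec_left_mem_low (h : IsMetricSystem A E F) (r : Fin (D + 1)) (v : X → ℂ) :
    E r *ᵥ v ∈ low E (r + 1) := by
  intro j hj
  rw [h.mulVec_mulVec, if_neg]
  rintro rfl
  omega

/-- The nonzero space `F r W` lies in the summand `a = r + 1`, `b = u + 1`; an invariant nonzero
subspace of `W` is `W`. -/
theorem splitSum_eq_self (hD : 1 ≤ D) (h : IsMetricSystem A E F) (h' : IsMetricSystem B F E)
    (hW : Irr E F W) {r s t u : Fin (D + 1)} (hF : HasRange F W r s) (hE : HasRange E W t u) :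
    splitSum E F (r + u + 2) W = W := by
  have hle : splitSum E F (r + u + 2) W ≤ W := splitSum_le fun _ _ _ v hv _ _ => hv
  refine (hW.2.2 _ (h.inv_splitSum hD h' hW.1 _) hle).resolve_left fun h0 => ?_
  obtain ⟨v, hv, hv0⟩ := hF.exists_left
  have : F r *ᵥ v ∈ splitSum E F (r + u + 2) W :=
    mem_splitSum (a := r + 1) (b := u + 1) (by omega) (hW.1.2 r v hv)
      (h'.mulVec_left_mem_low r v)
      (fun j hj => hE.eq_zero_of_gt j (Fin.lt_def.mpr hj) _ (hW.1.2 r v hv))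
  rw [h0] at this
  exact hv0 this

/-- A summand with `b ≤ t` is zero. If `n < s + t + 2`, every other summand has `a ≤ s`, so `F s`
would kill all of `W`. -/
theorem le_of_le_splitSum (h : IsMetricSystem A E F)
    {r s t u : Fin (D + 1)} (hF : HasRange F W r s) (hE : HasRange E W t u) {n : ℕ}
    (hn : W ≤ splitSum E F n W) : (s : ℕ) + t + 2 ≤ n := by
  by_contra hlt
  obtain ⟨v, hv, hv0⟩ := hF.exists_right
  refine hv0 ?_
  have hle : splitSum E F n W ≤ LinearMap.ker (Matrix.toLin' (F s)) := by
    refine splitSum_le fun a b hab v hv ha hb => ?_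
    rw [LinearMap.mem_ker, Matrix.toLin'_apply]
    by_cases hb' : b ≤ t
    · have : v = 0 := by
        rw [← h.sum_mulVec v]
        refine Finset.sum_eq_zero fun i _ => ?_
        rcases Nat.lt_or_ge i t with hi | hi
        · exact hE.eq_zero_of_lt i (Fin.lt_def.mpr hi) v hv
        · exact hb i (hb'.trans hi)
      rw [this, Matrix.mulVec_zero]
    · exact ha s (by omega)
  simpa using hle (hn hv)

/-- The two supports of an irreducible module have the same length. -/
theorem add_eq_add_of_irr (hD : 1 ≤ D) (h : IsMetricSystem A E F) (h' : IsMetricSystem B F E)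
    (hW : Irr E F W) {r s t u : Fin (D + 1)} (hF : HasRange F W r s) (hE : HasRange E W t u) :
    (s : ℕ) + t = r + u := by
  have h1 := h.le_of_le_splitSum hF hE (h.splitSum_eq_self hD h' hW hF hE).ge
  -- Exchanging the two systems gives the opposite inequality.
  have h2 := h'.le_of_le_splitSum hE hF (h'.splitSum_eq_self hD h hW.swap hE hF).ge
  omega

/-- The `F`-support of a nonzero invariant subspace reaches at least `D - r`. -/
theorem le_add_of_hasRange (h : IsMetricSystem A E F) (h' : IsMetricSystem B F E)
    (hW : Inv E F W) {r s : Fin (D + 1)} (hF : HasRange F W r s) : D ≤ (r : ℕ) + s := by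
  by_contra hlt
  obtain ⟨v, hv, hv0⟩ := hF.exists_left
  -- By the triangle condition `A D` sends `F r v` to indices at least `D - r`, all beyond `s`; the
  -- image is then zero, against injectivity of `A D`.
  refine hv0 (h.eq_zero_of_last_mulVec ?_)
  rw [← h'.sum_mulVec (A (Fin.last D) *ᵥ F r *ᵥ v)]
  refine Finset.sum_eq_zero fun j _ => ?_
  rcases lt_or_ge s j with hj | hj
  · exact hF.eq_zero_of_gt j hj _ (h.mulVec_mem_of_idempotent hW.1 _ _ (hW.2 r v hv))
  · have hj := Fin.le_def.mp hj
    rw [Matrix.mulVec_mulVec, Matrix.mulVec_mulVec,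
      h.triangle (Fin.last D) j r (Or.inl (by rw [Fin.val_last]; omega)), Matrix.zero_mulVec]

/-- Add `D ≤ r + s` and `D ≤ t + u`, and use `s + t = r + u`. -/
theorem le_add_of_irr (hD : 1 ≤ D) (h : IsMetricSystem A E F) (h' : IsMetricSystem B F E)
    (hW : Irr E F W) {r s t u : Fin (D + 1)} (hF : HasRange F W r s) (hE : HasRange E W t u) :
    D ≤ (s : ℕ) + t := by
  have h1 := h.add_eq_add_of_irr hD h' hW hF hE
  have h2 := h.le_add_of_hasRange h' hW.1 hF
  have h3 := h'.le_add_of_hasRange h hW.1.swap hE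
  omega

/-- The `F`-support of an irreducible module is an interval. -/
theorem exists_ne_zero_of_irr (hD : 1 ≤ D) (h : IsMetricSystem A E F) (h' : IsMetricSystem B F E)
    (hW : Irr E F W) {r s : Fin (D + 1)} (hF : HasRange F W r s) {i : Fin (D + 1)}
    (hri : r ≤ i) (his : i ≤ s) : ∃ v ∈ W, F i *ᵥ v ≠ 0 := by
  by_contra! hi
  -- `A 1` cannot cross a gap at `i`, since it raises the support by at most one; so the part of `W`
  -- below the gap is a submodule, neither zero nor `W`.
  have hinv : Inv E F (W ⊓ low F i) := by
    refine ⟨h.idempotent_mulVec_mem fun v hv => ⟨?_, fun j hj => ?_⟩, fun j v hv =>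
      ⟨hW.1.2 j v hv.1, h'.mulVec_mem_low hv.2⟩⟩
    · exact h.mulVec_mem_of_idempotent hW.1.1 1 v hv.1
    · rcases Nat.eq_or_lt_of_le hj with hj | hj
      · rw [← Fin.ext hj]
        exact hi _ (h.mulVec_mem_of_idempotent hW.1.1 1 v hv.1)
      · exact h.one_mulVec_mem_low hD h' hv.2 j hj
  rcases hW.2.2 _ hinv inf_le_left with h0 | h0
  · obtain ⟨v, hv, hv0⟩ := hF.exists_left
    have hlt : r < i := lt_of_le_of_ne hri (by rintro rfl; exact hv0 (hi v hv))
    have : F r *ᵥ v ∈ W ⊓ low F i :=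
      ⟨hW.1.2 r v hv, low_mono F (Fin.lt_def.mp hlt) (h'.mulVec_left_mem_low r v)⟩
    rw [h0] at this
    exact hv0 this
  · obtain ⟨v, hv, hv0⟩ := hF.exists_right
    rw [← h0] at hv
    exact hv0 (hv.2 s (Fin.le_def.mp his))

end IsMetricSystem

end

/-! ### Complete reducibility and the split sums of the whole space -/

noncomputable section

variable {X : Type*} [Fintype X] [DecidableEq X] {D : ℕ}

namespace IsMetricSystem

variable {A E F B : Fin (D + 1) → Matrix X X ℂ} {W U : Submodule ℂ (X → ℂ)}

/-- An invariant subspace is the image of a projection that commutes with all `E_i` and `F_i`. -/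
theorem exists_projection (h : IsMetricSystem A E F) (h' : IsMetricSystem B F E)
    (hW : Inv E F W) : ∃ P : (X → ℂ) →ₗ[ℂ] (X → ℂ), (∀ v, P v ∈ W) ∧ (∀ v ∈ W, P v = v) ∧
      (∀ i v, P (E i *ᵥ v) = E i *ᵥ P v) ∧ ∀ i v, P (F i *ᵥ v) = F i *ᵥ P v := by
  have hc := isCompl_perp W
  have hW' := hW.perp h.herm h'.herm
  let P := W.subtype ∘ₗ Submodule.projectionOnto W (perp W) hc
  have hl : ∀ v ∈ W, P v = v := fun v hv =>
    congrArg Subtype.val (Submodule.projectionOnto_apply_left hc ⟨v, hv⟩)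
  have hr : ∀ v ∈ perp W, P v = 0 := fun v hv =>
    congrArg Subtype.val (Submodule.projectionOnto_apply_right hc ⟨v, hv⟩)
  have hcomm : ∀ M : Matrix X X ℂ, (∀ v ∈ W, M *ᵥ v ∈ W) → (∀ v ∈ perp W, M *ᵥ v ∈ perp W) →
      ∀ v, P (M *ᵥ v) = M *ᵥ P v := by
    intro M h1 h2 v
    obtain ⟨w, hw, u, hu, rfl⟩ := Submodule.mem_sup.mp
      (hc.sup_eq_top ▸ Submodule.mem_top : v ∈ W ⊔ perp W)
    rw [Matrix.mulVec_add, map_add, map_add, hl w hw, hr u hu, hl _ (h1 w hw), hr _ (h2 u hu),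
      add_zero, add_zero]
  exact ⟨P, fun _ => Subtype.prop _, hl, fun i => hcomm _ (hW.1 i) (hW'.1 i),
    fun i => hcomm _ (hW.2 i) (hW'.2 i)⟩

/-- The projection onto `W` commutes with all `E i` and `F i`, so it maps each summand for `⊤` into
the corresponding summand for `W`. -/
theorem le_splitSum_self (h : IsMetricSystem A E F) (h' : IsMetricSystem B F E)
    (hW : Inv E F W) {n : ℕ} (hn : W ≤ splitSum E F n ⊤) : W ≤ splitSum E F n W := by
  obtain ⟨P, hP, hPW, hPE, hPF⟩ := h.exists_projection h' hW
  have hle : splitSum E F n ⊤ ≤ (splitSum E F n W).comap P :=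
    splitSum_le fun a b hab v _ ha hb => mem_splitSum hab (hP v)
      (fun j hj => by rw [← hPF, ha j hj, map_zero])
      (fun j hj => by rw [← hPE, hb j hj, map_zero])
  intro w hw
  have := hle (hn hw)
  rwa [Submodule.mem_comap, hPW w hw] at this

/-- An irreducible submodule would satisfy both `s + t + 2 ≤ n` and `D ≤ s + t`. -/
theorem splitSum_top_eq_bot (hD : 1 ≤ D) (h : IsMetricSystem A E F) (h' : IsMetricSystem B F E)
    {n : ℕ} (hn : n < D + 2) : splitSum E F n ⊤ = ⊥ := by
  by_contra h0
  obtain ⟨W, hWle, hW⟩ := exists_irr_le (h.inv_splitSum hD h' inv_top n) h0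
  obtain ⟨r, s, hF⟩ := h'.exists_hasRange hW.2.1
  obtain ⟨t, u, hE⟩ := h.exists_hasRange hW.2.1
  have h1 := h.le_of_le_splitSum hF hE (h.le_splitSum_self h' hW.1 hWle)
  have h2 := h.le_add_of_irr hD h' hW hF hE
  omega

theorem low_inf_low_eq_bot (hD : 1 ≤ D) (h : IsMetricSystem A E F) (h' : IsMetricSystem B F E)
    {a b : ℕ} (hab : a + b < D + 2) : low F a ⊓ low E b = ⊥ :=
  (Submodule.eq_bot_iff _).mpr fun _ hv => (Submodule.mem_bot ℂ).mp <|
    h.splitSum_top_eq_bot hD h' hab ▸ mem_splitSum rfl Submodule.mem_top hv.1 hv.2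

theorem iSupIndep_low_inf_low (hD : 1 ≤ D) (h : IsMetricSystem A E F)
    (h' : IsMetricSystem B F E) :
    iSupIndep fun i : Fin (D + 1) => low F (i + 1) ⊓ low E (D - i + 1) := by
  classical
  rw [iSupIndep_iff_finsetSum_eq_zero_imp_eq_zero]
  intro s v hv hsum
  by_contra! hne
  let S := s.filter fun i => v i ≠ 0
  have hS : S.Nonempty := by
    obtain ⟨i, hi, hi0⟩ := hne
    exact ⟨i, Finset.mem_filter.mpr ⟨hi, hi0⟩⟩
  -- In a vanishing sum, the nonzero term of largest index `m` is minus a sum of terms in `low F m`.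
  -- It thus gains one in the `F`-bound and lies in an intersection with total `D + 1`, which is
  -- zero.
  let m := S.max' hS
  have hm : m ∈ s ∧ v m ≠ 0 := Finset.mem_filter.mp (S.max'_mem hS)
  refine hm.2 ?_
  have hlow : v m ∈ low F m := by
    rw [← Finset.add_sum_erase _ _ hm.1] at hsum
    rw [eq_neg_of_add_eq_zero_left hsum]
    refine Submodule.neg_mem _ (Submodule.sum_mem _ fun i hi => ?_)
    by_cases hi0 : v i = 0
    · rw [hi0]; exact Submodule.zero_mem _
    · have his := Finset.mem_of_mem_erase hi
      have hlt : i < m := lt_of_le_of_ne (S.le_max' i (Finset.mem_filter.mpr ⟨his, hi0⟩))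
        (Finset.ne_of_mem_erase hi)
      exact low_mono F (Fin.lt_def.mp hlt) (hv i his).1
  have : v m ∈ low F m ⊓ low E (D - m + 1) := ⟨hlow, (hv m hm.1).2⟩
  rwa [h.low_inf_low_eq_bot hD h' (by omega), Submodule.mem_bot] at this

theorem splitSum_top_eq_iSup (h : IsMetricSystem A E F) (h' : IsMetricSystem B F E) :
    splitSum E F (D + 2) ⊤ = ⨆ i : Fin (D + 1), low F (i + 1) ⊓ low E (D - i + 1) := by
  refine le_antisymm (splitSum_le fun a b hab v _ ha hb => ?_)
    (iSup_le fun i v hv => mem_splitSum (by omega) Submodule.mem_top hv.1 hv.2)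
  rcases a with _ | a
  · rw [h'.low_zero, Submodule.mem_bot] at ha
    rw [ha]; exact Submodule.zero_mem _
  rcases b with _ | b
  · rw [h.low_zero, Submodule.mem_bot] at hb
    rw [hb]; exact Submodule.zero_mem _
  have ha' : a < D + 1 := by omega
  have hb' : b = D - a := by omega
  subst hb'
  exact le_iSup (fun i : Fin (D + 1) => low F (i + 1) ⊓ low E (D - i + 1)) ⟨a, ha'⟩ ⟨ha, hb⟩

theorem inv_sSup {S : Set (Submodule ℂ (X → ℂ))} (hS : ∀ W ∈ S, Inv E F W) :
    Inv E F (sSup S) := by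
  have key : ∀ M : Matrix X X ℂ, (∀ W ∈ S, ∀ v ∈ W, M *ᵥ v ∈ W) →
      ∀ v ∈ sSup S, M *ᵥ v ∈ sSup S := by
    intro M hM
    suffices hs : sSup S ≤ (sSup S).comap (Matrix.toLin' M) from fun v hv => by simpa using hs hv
    refine sSup_le fun W hW v hv => ?_
    rw [Submodule.mem_comap, Matrix.toLin'_apply]
    exact le_sSup hW (hM W hW v hv)
  exact ⟨fun i => key _ fun W hW => (hS W hW).1 i, fun i => key _ fun W hW => (hS W hW).2 i⟩

/-- An invariant subspace is contained in any sum of irreducible subspaces that comprises all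
its irreducible subspaces. -/
theorem le_sSup_of_irr (h : IsMetricSystem A E F) (h' : IsMetricSystem B F E)
    (hU : Inv E F U) {S : Set (Submodule ℂ (X → ℂ))} (hS : ∀ W ∈ S, Inv E F W)
    (hirr : ∀ W ≤ U, Irr E F W → W ∈ S) : U ≤ sSup S := by
  have hN := inv_sSup hS
  have hK := hU.inf hN
  have h0 : U ⊓ perp (U ⊓ sSup S) = ⊥ := by
    by_contra h0
    obtain ⟨W, hWle, hW⟩ := exists_irr_le (hU.inf (hK.perp h.herm h'.herm)) h0
    refine hW.2.1 (le_bot_iff.mp ?_)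
    rw [← (isCompl_perp (U ⊓ sSup S)).inf_eq_bot]
    have hWU := hWle.trans inf_le_left
    exact le_inf (le_inf hWU (le_sSup (hirr W hWU hW))) (hWle.trans inf_le_right)
  -- Modular law: `U` is the sum of `U ⊓ sSup S` and the part of `U` orthogonal to it, which is
  -- zero.
  have hsup : U = U ⊓ sSup S ⊔ perp (U ⊓ sSup S) ⊓ U := by
    rw [← sup_inf_assoc_of_le _ inf_le_left, (isCompl_perp (U ⊓ sSup S)).sup_eq_top, top_inf_eq]
  rw [inf_comm (perp _), h0, sup_bot_eq] at hsup
  exact hsup.le.trans inf_le_right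

/-- The support of an irreducible module is an interval. -/
theorem support_eq_Icc (hD : 1 ≤ D) (h : IsMetricSystem A E F) (h' : IsMetricSystem B F E)
    (hW : Irr E F W) {r s : Fin (D + 1)} (hF : HasRange F W r s) :
    support F W = Set.Icc (r : ℕ) s := by
  have hact : ∀ j, act (F j) W ≠ ⊥ ↔ ∃ v ∈ W, F j *ᵥ v ≠ 0 := by
    intro j
    simp [act, Submodule.ne_bot_iff]
  ext i
  constructor
  · rintro ⟨j, rfl, hj⟩
    obtain ⟨v, hv, hv0⟩ := (hact j).mp hj
    exact ⟨not_lt.mp fun hlt => hv0 (hF.eq_zero_of_lt j hlt v hv),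
      not_lt.mp fun hlt => hv0 (hF.eq_zero_of_gt j hlt v hv)⟩
  · rintro ⟨hri, his⟩
    exact ⟨⟨i, by omega⟩, rfl, (hact _).mpr (h.exists_ne_zero_of_irr hD h' hW hF hri his)⟩

end IsMetricSystem

end

/-! ### The metric systems of the graph and of its dual -/

noncomputable section

variable {X : Type*} {D : ℕ}

theorem exists_dist_eq_one_of_dist_eq_succ {G : SimpleGraph X} (hG : G.Connected) {u v : X}
    {n : ℕ} (h : G.dist u v = n + 1) : ∃ w, G.dist u w = 1 ∧ G.dist w v = n := by
  obtain ⟨p, hp⟩ := hG.exists_walk_length_eq_dist u v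
  cases p with
  | nil => simp at h
  | @cons _ w _ hadj q =>
    have h1 : G.dist u w = 1 := SimpleGraph.dist_eq_one_iff_adj.mpr hadj
    refine ⟨w, h1, ?_⟩
    have h2 := SimpleGraph.dist_le q
    have h3 := hG.dist_triangle (u := u) (v := w) (w := v)
    rw [SimpleGraph.Walk.length_cons] at hp
    omega

theorem exists_dist_eq {G : SimpleGraph X} (hG : G.Connected) {h : ℕ} (hh : h ≤ G.diam) :
    ∃ u v, G.dist u v = h := by
  have := hG.nonempty
  induction hh using Nat.decreasingInduction with
  | self => exact G.exists_dist_eq_diam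
  | of_succ k _ ih =>
    obtain ⟨u, v, huv⟩ := ih
    obtain ⟨w, -, hw⟩ := exists_dist_eq_one_of_dist_eq_succ hG huv
    exact ⟨w, v, hw⟩

section

variable [Fintype X]

theorem dist_le_of_diam_eq {G : SimpleGraph X} (hG : G.Connected) (hD : G.diam = D) (u v : X) :
    G.dist u v ≤ D := by
  have := hG.nonempty
  rw [← hD]
  exact SimpleGraph.dist_le_diam (SimpleGraph.connected_iff_ediam_ne_top.mp hG)

theorem distMatrix_mul_apply (G : SimpleGraph X) (i j : ℕ) (y z : X) :
    (distMatrix G i * distMatrix G j) y z =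
      ({w : X | G.dist y w = i ∧ G.dist z w = j}.ncard : ℂ) := by
  classical
  rw [Set.ncard_eq_toFinset_card', Matrix.mul_apply, Set.toFinset_ofPred, Finset.card_filter]
  push_cast
  refine Finset.sum_congr rfl fun w _ => ?_
  simp only [distMatrix, Matrix.of_apply, G.dist_comm (u := w) (v := z)]
  split_ifs <;> simp_all

theorem exists_distMatrix_recurrence {G : SimpleGraph X} (hG : IsDistanceRegular G)
    (hD : G.diam = D) : ∃ p : Fin (D + 1) → Fin (D + 1) → ℂ,
    (∀ i : Fin (D + 1), distMatrix G 1 * distMatrix G i = ∑ h, p h i • distMatrix G h) ∧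
    (∀ h i : Fin (D + 1), ((h : ℕ) > i + 1 ∨ (i : ℕ) > h + 1) → p h i = 0) ∧
    (∀ h i : Fin (D + 1), ((h : ℕ) = i + 1 ∨ (i : ℕ) = h + 1) → p h i ≠ 0) := by
  have hex : ∀ h : Fin (D + 1), ∃ y z, G.dist y z = h := fun h =>
    exists_dist_eq hG.1 (by omega)
  choose y z hyz using hex
  -- The coefficients are the intersection numbers, read off from a chosen pair at each distance
  -- `h`.
  refine ⟨fun h i => ({w : X | G.dist (y h) w = 1 ∧ G.dist (z h) w = i}.ncard : ℂ), ?_, ?_, ?_⟩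
  · intro i
    ext u v
    have hle := dist_le_of_diam_eq hG.1 hD u v
    rw [distMatrix_mul_apply, Matrix.sum_apply,
      Finset.sum_eq_single ⟨G.dist u v, by omega⟩]
    · simp only [Matrix.smul_apply, distMatrix, Matrix.of_apply, if_true, smul_eq_mul, mul_one]
      rw [hG.2 u v _ _ (hyz ⟨G.dist u v, by omega⟩).symm]
    · intro h _ hne
      rw [Matrix.smul_apply, distMatrix, Matrix.of_apply, if_neg, smul_zero]
      exact fun hh => hne (Fin.ext hh.symm)
    · simp
  · intro h i hhi
    rw [Nat.cast_eq_zero, Set.ncard_eq_zero, Set.eq_empty_iff_forall_notMem]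
    rintro w ⟨h1, h2⟩
    have t1 := hG.1.dist_triangle (u := y h) (v := w) (w := z h)
    have t2 := hG.1.dist_triangle (u := z h) (v := y h) (w := w)
    rw [G.dist_comm (u := w)] at t1
    rw [G.dist_comm (u := z h) (v := y h)] at t2
    have := hyz h
    omega
  · intro h i hhi
    rw [Nat.cast_ne_zero, ← Nat.pos_iff_ne_zero, Set.ncard_pos]
    rcases hhi with hhi | hhi
    · obtain ⟨w, h1, h2⟩ := exists_dist_eq_one_of_dist_eq_succ hG.1 ((hyz h).trans hhi)
      exact ⟨w, h1, G.dist_comm.trans h2⟩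
    -- Here `i = h + 1`. A neighbour `w` of `y i` on a geodesic to `z i` has distance `h` from `z
    -- i`, and `y i` witnesses nonemptiness for the pair `(w, z i)`; regularity carries this to `(y
    -- h, z h)`.
    · obtain ⟨w, h1, h2⟩ := exists_dist_eq_one_of_dist_eq_succ hG.1 ((hyz i).trans hhi)
      have := hG.2 (y h) (z h) w (z i) ((hyz h).trans h2.symm) 1 i
      rw [← Set.ncard_pos, this, Set.ncard_pos]
      exact ⟨y i, G.dist_comm.trans h1, G.dist_comm.trans (hyz i)⟩

end

section

variable [DecidableEq X]

/-- The diagonal matrix formed by row `x` of a matrix. -/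
def rowDiagonal (x : X) : Matrix X X ℂ →ₗ[ℂ] Matrix X X ℂ where
  toFun B := Matrix.diagonal (B x)
  map_add' B C := (Matrix.diagonal_add (B x) (C x)).symm
  map_smul' c B := (Matrix.diagonal_smul c (B x))

theorem rowDiagonal_apply (x : X) (B : Matrix X X ℂ) :
    rowDiagonal x B = Matrix.diagonal (B x) := rfl

end

variable [Fintype X] [DecidableEq X]

theorem isMetricSystem_distMatrix {G : SimpleGraph X} (hG : IsDistanceRegular G)
    (hD : G.diam = D) (hD1 : 1 ≤ D) {E : Fin (D + 1) → Matrix X X ℂ}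
    (hE : IsPrimitiveIdempotents G E) (x : X) :
    IsMetricSystem (fun i : Fin (D + 1) => distMatrix G i) E (dualIdempotent G x D) where
  zero_eq := by
    ext y z
    simp [distMatrix, Matrix.one_apply, hG.1.dist_eq_zero_iff]
  recurrence := by
    have h1 : ((1 : Fin (D + 1)) : ℕ) = 1 := by
      rw [Fin.val_one', Nat.mod_eq_of_lt (by omega)]
    rw [h1]
    exact exists_distMatrix_recurrence hG hD
  span_eq := hE.span_eq
  sum_eq := hE.sum_eq
  mul_eq := hE.mul_eq
  herm i := by
    rw [Matrix.conjTranspose, hE.transpose_eq]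
    exact hE.conj_eq i
  triangle h i j hh := by
    ext y z
    simp only [dualIdempotent, Matrix.mul_diagonal, Matrix.diagonal_mul, distMatrix,
      Matrix.of_apply, Matrix.zero_apply]
    by_contra hne
    have h1 : G.dist x y = i := by by_contra hc; simp [hc] at hne
    have h2 : G.dist y z = h := by by_contra hc; simp [hc] at hne
    have h3 : G.dist x z = j := by by_contra hc; simp [hc] at hne
    have t1 := hG.1.dist_triangle (u := x) (v := y) (w := z)
    have t2 := hG.1.dist_triangle (u := y) (v := x) (w := z)
    have t3 := hG.1.dist_triangle (u := x) (v := z) (w := y)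
    rw [G.dist_comm (u := y) (v := x)] at t2
    rw [G.dist_comm (u := z) (v := y)] at t3
    omega

/-- The dual distance matrices `A*_i = A*_i(x)`. -/
def dualDistMatrix (E : Fin (D + 1) → Matrix X X ℂ) (x : X) (i : Fin (D + 1)) : Matrix X X ℂ :=
  rowDiagonal x ((Fintype.card X : ℂ) • E i)

/-- Row `x` of the `i`th distance matrix is the diagonal of the `i`th dual idempotent, so both spans
are the image of the Bose-Mesner algebra under `rowDiagonal x`. -/
theorem span_dualIdempotent_eq {G : SimpleGraph X} {E : Fin (D + 1) → Matrix X X ℂ}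
    (hE : IsPrimitiveIdempotents G E) (x : X) :
    Submodule.span ℂ (Set.range (dualIdempotent G x D)) =
      Submodule.span ℂ (Set.range (dualDistMatrix E x)) := by
  have : Nonempty X := ⟨x⟩
  have hn : (Fintype.card X : ℂ) ≠ 0 := Nat.cast_ne_zero.mpr Fintype.card_ne_zero
  have h1 : Set.range (dualIdempotent G x D) =
      rowDiagonal x '' Set.range fun i : Fin (D + 1) => distMatrix G i := by
    rw [← Set.range_comp]; rfl
  rw [h1, Submodule.span_image]
  have h2 := hE.span_eq
  rw [boseMesner] at h2
  rw [← h2, ← Submodule.span_image, ← Set.range_comp]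
  refine le_antisymm (Submodule.span_le.mpr ?_) (Submodule.span_le.mpr ?_)
  · rintro _ ⟨i, rfl⟩
    have : (rowDiagonal x ∘ E) i = (Fintype.card X : ℂ)⁻¹ • dualDistMatrix E x i := by
      rw [dualDistMatrix, map_smul, inv_smul_smul₀ hn, Function.comp_apply]
    rw [this]
    exact Submodule.smul_mem _ _ (Submodule.subset_span ⟨i, rfl⟩)
  · rintro _ ⟨i, rfl⟩
    rw [dualDistMatrix, map_smul]
    exact Submodule.smul_mem _ _ (Submodule.subset_span ⟨i, rfl⟩)

/-- `rowDiagonal x` turns entrywise products into matrix products, so the Krein parameters become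
structure constants. -/
theorem dualDistMatrix_mul {E : Fin (D + 1) → Matrix X X ℂ}
    {q : Fin (D + 1) → Fin (D + 1) → Fin (D + 1) → ℂ} (hq : IsKreinParameters E q) (x : X)
    (i j : Fin (D + 1)) :
    dualDistMatrix E x i * dualDistMatrix E x j = ∑ h, q h i j • dualDistMatrix E x h := by
  have : Nonempty X := ⟨x⟩
  have hn : (Fintype.card X : ℂ) ≠ 0 := Nat.cast_ne_zero.mpr Fintype.card_ne_zero
  have e : dualDistMatrix E x i * dualDistMatrix E x j =
      rowDiagonal x (((Fintype.card X : ℂ) * Fintype.card X) • (E i ⊙ E j)) := by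
    rw [dualDistMatrix, dualDistMatrix, rowDiagonal_apply, rowDiagonal_apply, rowDiagonal_apply,
      Matrix.diagonal_mul_diagonal]
    congr 1
    funext y
    simp only [Matrix.smul_apply, Matrix.hadamard_apply, smul_eq_mul]
    ring
  rw [e, hq i j, smul_smul, mul_assoc, mul_inv_cancel₀ hn, mul_one, Finset.smul_sum, map_sum]
  refine Finset.sum_congr rfl fun h _ => ?_
  rw [smul_comm, map_smul, dualDistMatrix]

open scoped ComplexOrder in
/-- A vanishing Krein parameter `q^h_{i,j}` makes the triple product `E_i A*_h E_j` vanish. -/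
theorem mul_dualDistMatrix_mul_eq_zero {G : SimpleGraph X} {E : Fin (D + 1) → Matrix X X ℂ}
    (hE : IsPrimitiveIdempotents G E) {q : Fin (D + 1) → Fin (D + 1) → Fin (D + 1) → ℂ}
    (hq : IsKreinParameters E q) (x : X) {h i j : Fin (D + 1)} (h0 : q h i j = 0) :
    E i * dualDistMatrix E x h * E j = 0 := by
  have herm : ∀ i, (E i)ᴴ = E i := fun i => by
    rw [Matrix.conjTranspose, hE.transpose_eq]
    exact hE.conj_eq i
  have hA : (dualDistMatrix E x h)ᴴ = dualDistMatrix E x h := by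
    rw [dualDistMatrix, rowDiagonal_apply, Matrix.diagonal_conjTranspose]
    congr 1
    funext y
    have := congrFun (congrFun (hE.conj_eq h) x) y
    simp only [Matrix.map_apply] at this
    simp [this]
  have key : E h * (E i ⊙ E j) * E h = 0 := by
    rw [hq i j, Matrix.mul_smul, Matrix.smul_mul, Finset.mul_sum, Finset.sum_mul,
      Finset.sum_eq_zero, smul_zero]
    intro l _
    rw [Matrix.mul_smul, hE.mul_eq, Matrix.smul_mul]
    split_ifs with hl
    · rw [← hl, h0, zero_smul]
    · rw [Matrix.zero_mul, smul_zero]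
  -- The squared Frobenius norm of the triple product equals `|X|²` times the `(x, x)`-entry of `E h
  -- * (E i ⊙ E j) * E h`, which vanishes by `key`.
  rw [← Matrix.trace_mul_conjTranspose_self_eq_zero_iff, Matrix.conjTranspose_mul,
    Matrix.conjTranspose_mul, herm, herm, hA]
  have e1 : E i * dualDistMatrix E x h * E j * (E j * (dualDistMatrix E x h * E i)) =
      E i * (dualDistMatrix E x h * E j * dualDistMatrix E x h * E i) := by
    have := hE.mul_eq j j
    rw [if_pos rfl] at this
    simp only [Matrix.mul_assoc]
    rw [← Matrix.mul_assoc (E j) (E j), this]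
  rw [e1, Matrix.trace_mul_comm, Matrix.mul_assoc, (by simpa using hE.mul_eq i i : E i * E i = E i)]
  have e2 := congrFun (congrFun key x) x
  simp only [Matrix.mul_apply, Matrix.zero_apply, Finset.sum_mul] at e2
  have hc : ∀ l y z, E l y z = E l z y := fun l y z =>
    congrFun (congrFun (hE.transpose_eq l) z) y
  rw [Matrix.trace]
  simp only [Matrix.diag_apply, Matrix.mul_apply (N := E i), dualDistMatrix, rowDiagonal_apply,
    Matrix.mul_diagonal, Matrix.diagonal_mul, Matrix.smul_apply, smul_eq_mul]
  rw [← mul_zero ((Fintype.card X : ℂ) * Fintype.card X), ← e2, Finset.sum_comm, Finset.mul_sum]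
  refine Finset.sum_congr rfl fun y _ => ?_
  rw [Finset.mul_sum]
  refine Finset.sum_congr rfl fun z _ => ?_
  rw [Matrix.hadamard_apply, hc i y z, hc j z y, hc h y x]
  ring

theorem isMetricSystem_dualDistMatrix {G : SimpleGraph X} (hG : G.Connected)
    (hD : G.diam = D) (hD1 : 1 ≤ D) {E : Fin (D + 1) → Matrix X X ℂ}
    (hE : IsPrimitiveIdempotents G E) (hQ : IsQPolynomial E) (x : X) :
    IsMetricSystem (dualDistMatrix E x) (dualIdempotent G x D) E := by
  have : Nonempty X := ⟨x⟩
  have hn : (Fintype.card X : ℂ) ≠ 0 := Nat.cast_ne_zero.mpr Fintype.card_ne_zero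
  obtain ⟨q, hq, hqz⟩ := hQ
  have h1 : ((1 : Fin (D + 1)) : ℕ) = 1 := by
    rw [Fin.val_one', Nat.mod_eq_of_lt (by omega)]
  exact
  { zero_eq := by
      rw [dualDistMatrix, rowDiagonal_apply, hE.zero_eq, ← Matrix.diagonal_one]
      congr 1
      funext y
      simp [hn]
    recurrence := ⟨fun h i => q h 1 i, fun i => dualDistMatrix_mul hq x 1 i,
      fun h i hh => (hqz h 1 i).1 (by omega), fun h i hh => (hqz h 1 i).2 (by omega)⟩
    span_eq := span_dualIdempotent_eq hE x
    sum_eq := by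
      ext y z
      rw [Matrix.sum_apply, Finset.sum_eq_single
        ⟨G.dist x y, Nat.lt_succ_of_le (dist_le_of_diam_eq hG hD x y)⟩]
      · simp [dualIdempotent, Matrix.diagonal_apply, Matrix.one_apply]
      · intro i _ hi
        have : G.dist x y ≠ i := fun hh => hi (Fin.ext hh.symm)
        simp [dualIdempotent, Matrix.diagonal_apply, this]
      · simp
    mul_eq := fun i j => by
      rw [dualIdempotent, dualIdempotent, Matrix.diagonal_mul_diagonal]
      split_ifs with hij
      · subst hij
        simp
      · rw [← Matrix.diagonal_zero]
        congr 1
        funext y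
        by_cases hy : G.dist x y = i
        · have : G.dist x y ≠ j := fun hh => hij (Fin.ext (hy.symm.trans hh))
          simp [this]
        · simp [hy]
    herm := fun i => by
      rw [dualIdempotent, Matrix.diagonal_conjTranspose]
      congr 1
      funext y
      simp [apply_ite]
    triangle := fun h i j hh => mul_dualDistMatrix_mul_eq_zero hE hq x ((hqz h i j).1 hh) }

end

/-! ### Modules of the Terwilliger algebra, displacement and the nucleus -/

noncomputable section

variable {X : Type*} [Fintype X] [DecidableEq X] {D : ℕ}

theorem isTModule_terwilliger_iff {G : SimpleGraph X} {E : Fin (D + 1) → Matrix X X ℂ}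
    (hE : IsPrimitiveIdempotents G E) (x : X) (W : Submodule ℂ (X → ℂ)) :
    IsTModule (terwilliger G x D) W ↔ Inv E (dualIdempotent G x D) W := by
  constructor
  · intro hW
    refine ⟨fun i => hW _ (Algebra.subset_adjoin (Or.inl ?_)),
      fun i => hW _ (Algebra.subset_adjoin (Or.inr (Submodule.subset_span ⟨i, rfl⟩)))⟩
    rw [← hE.span_eq]
    exact Submodule.subset_span ⟨i, rfl⟩
  · intro hW B hB
    have hspan : ∀ F : Fin (D + 1) → Matrix X X ℂ, (∀ i, ∀ v ∈ W, F i *ᵥ v ∈ W) →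
        ∀ M ∈ Submodule.span ℂ (Set.range F), ∀ v ∈ W, M *ᵥ v ∈ W := by
      intro F hF M hM v hv
      obtain ⟨c, rfl⟩ := (Submodule.mem_span_range_iff_exists_fun ℂ).mp hM
      rw [Matrix.sum_mulVec]
      exact W.sum_mem fun j _ => by rw [Matrix.smul_mulVec]; exact W.smul_mem _ (hF j v hv)
    induction hB using Algebra.adjoin_induction with
    | mem M hM =>
      rcases hM with hM | hM
      · rw [← hE.span_eq] at hM
        exact hspan E hW.1 M hM
      · exact hspan _ hW.2 M hM
    | algebraMap r =>
      intro v hv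
      rw [Algebra.algebraMap_eq_smul_one, Matrix.smul_mulVec, Matrix.one_mulVec]
      exact W.smul_mem _ hv
    | add M N _ _ hM hN =>
      intro v hv
      rw [Matrix.add_mulVec]
      exact W.add_mem (hM v hv) (hN v hv)
    | mul M N _ _ hM hN =>
      intro v hv
      rw [← Matrix.mulVec_mulVec]
      exact hM _ (hN v hv)

theorem isIrreducibleTModule_terwilliger_iff {G : SimpleGraph X}
    {E : Fin (D + 1) → Matrix X X ℂ} (hE : IsPrimitiveIdempotents G E) (x : X)
    (W : Submodule ℂ (X → ℂ)) :
    IsIrreducibleTModule (terwilliger G x D) W ↔ Irr E (dualIdempotent G x D) W := by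
  simp only [IsIrreducibleTModule, Irr, isTModule_terwilliger_iff hE]

/-- As the support is the interval from `r` to `s`, the diameter is `s - r` and the endpoint `r`
cancels. -/
theorem displacement_eq (hD : 1 ≤ D) {G : SimpleGraph X} {x : X}
    {A B E : Fin (D + 1) → Matrix X X ℂ} (h : IsMetricSystem A E (dualIdempotent G x D))
    (h' : IsMetricSystem B (dualIdempotent G x D) E) {W : Submodule ℂ (X → ℂ)}
    (hW : Irr E (dualIdempotent G x D) W) {r s t u : Fin (D + 1)}
    (hF : HasRange (dualIdempotent G x D) W r s) (hE : HasRange E W t u) :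
    displacement G x E W = (s : ℤ) + t - D := by
  have hrs : (r : ℕ) ≤ s := hF.le
  have htu : (t : ℕ) ≤ u := hE.le
  rw [displacement, endpoint, dualEndpoint, diameter, h.support_eq_Icc hD h' hW hF,
    h'.support_eq_Icc hD h hW.swap hE, csInf_Icc hrs, csInf_Icc htu, Set.ncard_eq_toFinset_card',
    Set.toFinset_Icc, Nat.card_Icc]
  omega

theorem nucleusPart_eq {G : SimpleGraph X} {x : X} {A B E : Fin (D + 1) → Matrix X X ℂ}
    (h : IsMetricSystem A E (dualIdempotent G x D))
    (h' : IsMetricSystem B (dualIdempotent G x D) E) (i : Fin (D + 1)) :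
    nucleusPart G x E i = low (dualIdempotent G x D) (i + 1) ⊓ low E (D - i + 1) := by
  rw [nucleusPart, h.low_succ_eq_iSup, h'.low_succ_eq_iSup]

theorem splitSum_top_eq_nucleus (hD : 1 ≤ D) {G : SimpleGraph X} {x : X}
    {A B E : Fin (D + 1) → Matrix X X ℂ} (hE : IsPrimitiveIdempotents G E)
    (h : IsMetricSystem A E (dualIdempotent G x D))
    (h' : IsMetricSystem B (dualIdempotent G x D) E) :
    splitSum E (dualIdempotent G x D) (D + 2) ⊤ = nucleus G x E := by
  rw [nucleus]
  simp only [isIrreducibleTModule_terwilliger_iff hE]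
  refine le_antisymm (h.le_sSup_of_irr h' (h.inv_splitSum hD h' inv_top _)
    (fun W hW => hW.1.1) fun W hWle hW => ⟨hW, ?_⟩) (sSup_le ?_)
  · obtain ⟨r, s, hF⟩ := h'.exists_hasRange hW.2.1
    obtain ⟨t, u, hE⟩ := h.exists_hasRange hW.2.1
    have h1 := h.le_of_le_splitSum hF hE (h.le_splitSum_self h' hW.1 hWle)
    have h2 := h.le_add_of_irr hD h' hW hF hE
    rw [displacement_eq hD h h' hW hF hE]
    omega
  · rintro W ⟨hW, hdisp⟩
    obtain ⟨r, s, hF⟩ := h'.exists_hasRange hW.2.1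
    obtain ⟨t, u, hE⟩ := h.exists_hasRange hW.2.1
    rw [displacement_eq hD h h' hW hF hE] at hdisp
    have h1 := h.add_eq_add_of_irr hD h' hW hF hE
    have h2 := h.splitSum_eq_self hD h' hW hF hE
    -- Displacement `0` says `s + t = D`, and `s + t = r + u`.
    rw [show (r : ℕ) + u + 2 = D + 2 by omega] at h2
    rw [← h2]
    exact splitSum_le fun a b hab v _ ha hb => mem_splitSum hab Submodule.mem_top ha hb

end

end DRG

theorem theorem7p4 {X : Type*} [Fintype X] [DecidableEq X] (G : SimpleGraph X)
    (hG : DRG.IsDistanceRegular G) {D : ℕ} (hD : G.diam = D) (hD1 : 1 ≤ D)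
    (E : Fin (D + 1) → Matrix X X ℂ) (hE : DRG.IsPrimitiveIdempotents G E)
    (hQ : DRG.IsQPolynomial E) (x : X) :
    iSupIndep (DRG.nucleusPart G x E) ∧
      ⨆ i, DRG.nucleusPart G x E i = DRG.nucleus G x E := by
  have h := DRG.isMetricSystem_distMatrix hG hD hD1 hE x
  have h' := DRG.isMetricSystem_dualDistMatrix hG.1 hD hD1 hE hQ x
  rw [funext (DRG.nucleusPart_eq h h'), ← h.splitSum_top_eq_iSup h']
  exact ⟨h.iSupIndep_low_inf_low hD1 h', DRG.splitSum_top_eq_nucleus hD1 hE h h'⟩
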